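/- Let $C$ be an algebraically closed field of characteristic zero, let $k=C(t)$ with the derivation $\delta=\frac{d}{dt}$, and let $A$ be an $n\times n$ matrix over $k$. Let $K$ be a Picard-Vessiot extension field of $k$ for $\delta(Y)=AY$, that is, a differential field extension of $k$ without new constants that is generated as a field over $k$ by the entries of a fundamental matrix (a matrix $F\in\mathrm{GL}_n(K)$ with $\delta(F)=AF$). Let $V=\{y\in K^n : \delta(y)=Ay\}$ be the solution space, a $C$-vector space, and let $\mathcal G=\mathrm{Gal}(K/k)$ be the group of field automorphisms of $K$ that fix $k$ elementwise and commute with $\delta$; it acts on $V$ coordinate by coordinate. A $C$-subspace $W\subseteq V$ with a basis $\mathbf w_1,\dots,\mathbf w_m$ is called $k$-definable if there is $M\in\mathrm{GL}_n(k)$ such that $$M\,(\mathbf w_1,\dots,\mathbf w_m)=\begin{pmatrix}\tilde W\\ 0\end{pmatrix}$$ with an invertible $m\times m$ matrix $\tilde W$ over $K$ (this does not depend on the choice of the basis). Then for every $C$-subspace $W$ of $V$ the following are equivalent: (a) $W$ is $k$-definable; (b) $W$ is a $\mathcal G$-submodule of $V$, i.e. $\sigma(W)\subseteq W$ for all $\sigma\in\mathcal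 G$. -/

import Mathlib

open scoped Differential

noncomputable section

/-! ### The differential field `C(t)` with the derivation `d/dt` -/

/-- The differential ring structure given by a derivation over any base ring. -/
abbrev differentialOfDerivation {R S : Type*} [CommRing R] [CommRing S] [Algebra R S]
    (D : Derivation R S S) : Differential S where
  deriv := D.restrictScalars ℤ

namespace RatFunc

variable {C : Type*} [Field C]

/-- The quotient rule: `(p / q)' = (p' q - p q') / q ^ 2`, for the reduced fraction `p / q`. -/
def ddtFun (f : RatFunc C) : RatFunc C :=
  (algebraMap (Polynomial C) (RatFunc C)
      (Polynomial.derivative f.num * f.denom - f.num * Polynomial.derivative f.denom)) /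
    (algebraMap (Polynomial C) (RatFunc C) f.denom) ^ 2

lemma ddtFun_div (p q : Polynomial C) (hq : q ≠ 0) :
    ddtFun (algebraMap (Polynomial C) (RatFunc C) p / algebraMap (Polynomial C) (RatFunc C) q) =
      (algebraMap (Polynomial C) (RatFunc C)
        (Polynomial.derivative p * q - p * Polynomial.derivative q)) /
        (algebraMap (Polynomial C) (RatFunc C) q) ^ 2 := by
  set f : RatFunc C :=
    algebraMap (Polynomial C) (RatFunc C) p / algebraMap (Polynomial C) (RatFunc C) q with hf
  have hd : f.denom ≠ 0 := f.denom_ne_zero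
  have hq' : algebraMap (Polynomial C) (RatFunc C) q ≠ 0 := RatFunc.algebraMap_ne_zero hq
  have hd' : algebraMap (Polynomial C) (RatFunc C) f.denom ≠ 0 := RatFunc.algebraMap_ne_zero hd
  have key : f.num * q = p * f.denom := by
    have h := f.num_div_denom
    rw [hf, ← hf, div_eq_div_iff hd' hq', ← map_mul, ← map_mul] at h
    exact RatFunc.algebraMap_injective C h
  have dkey := congrArg Polynomial.derivative key
  simp only [Polynomial.derivative_mul] at dkey
  rw [ddtFun, div_eq_div_iff (pow_ne_zero 2 hd') (pow_ne_zero 2 hq'), ← map_pow, ← map_pow,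
    ← map_mul, ← map_mul]
  congr 1
  linear_combination (f.denom * q) * dkey -
    (f.denom * Polynomial.derivative q + q * Polynomial.derivative f.denom) * key

/-- The derivation `d/dt` of `C(t)`, as a `C`-linear derivation. -/
def ddt (C : Type*) [Field C] : Derivation C (RatFunc C) (RatFunc C) :=
  Derivation.mk'
    { toFun := ddtFun
      map_add' := by
        intro x y
        induction x using RatFunc.induction_on with
        | _ p q hq =>
        induction y using RatFunc.induction_on with
        | _ r s hs =>
        have hq' := RatFunc.algebraMap_ne_zero hq
        have hs' := RatFunc.algebraMap_ne_zero hs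
        rw [ddtFun_div p q hq, ddtFun_div r s hs, div_add_div _ _ hq' hs', ← map_mul, ← map_mul,
          ← map_mul, ← map_add, ddtFun_div _ _ (mul_ne_zero hq hs)]
        simp only [Polynomial.derivative_mul, map_add, map_sub, map_mul]
        field_simp
        ring
      map_smul' := by
        intro c x
        induction x using RatFunc.induction_on with
        | _ p q hq =>
        have hq' := RatFunc.algebraMap_ne_zero hq
        have h : c • (algebraMap (Polynomial C) (RatFunc C) p /
            algebraMap (Polynomial C) (RatFunc C) q) =
            algebraMap (Polynomial C) (RatFunc C) (Polynomial.C c * p) /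
              algebraMap (Polynomial C) (RatFunc C) q := by
          rw [Algebra.smul_def, map_mul, RatFunc.algebraMap_C, RatFunc.algebraMap_eq_C, mul_div_assoc]
        rw [h, ddtFun_div _ _ hq, ddtFun_div _ _ hq, RingHom.id_apply, Algebra.smul_def,
          RatFunc.algebraMap_eq_C, ← RatFunc.algebraMap_C]
        simp only [Polynomial.derivative_mul, Polynomial.derivative_C, map_add, map_sub, map_mul,
          map_zero]
        field_simp
        ring }
    (by
      intro x y
      induction x using RatFunc.induction_on with
      | _ p q hq =>
      induction y using RatFunc.induction_on with
      | _ r s hs =>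
      have hq' := RatFunc.algebraMap_ne_zero hq
      have hs' := RatFunc.algebraMap_ne_zero hs
      simp only [LinearMap.coe_mk, AddHom.coe_mk, smul_eq_mul]
      rw [ddtFun_div p q hq, ddtFun_div r s hs, div_mul_div_comm, ← map_mul, ← map_mul,
        ddtFun_div _ _ (mul_ne_zero hq hs)]
      simp only [Polynomial.derivative_mul, map_add, map_sub, map_mul]
      field_simp
      ring)

/-- `C(t)` is a differential field with the derivation `d/dt`. -/
instance instDifferentialDdt : Differential (RatFunc C) :=
  differentialOfDerivation (ddt C)

lemma deriv_algebraMap_const (c : C) : (algebraMap C (RatFunc C) c)′ = 0 :=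
  (ddt C).map_algebraMap c

end RatFunc

namespace LinearODE

section General

variable {k K : Type*} [Field k] [Field K] [Differential k] [Differential K] [Algebra k K]

/-- `F ∈ GL_n(K)` is a fundamental matrix of `δ(Y) = A Y`: it is invertible and `δ(F) = A F`. -/
def IsFundamentalMatrix {n : ℕ} (A : Matrix (Fin n) (Fin n) k) (F : Matrix (Fin n) (Fin n) K) :
    Prop :=
  IsUnit F ∧ F.map (fun x => x′) = A.map (algebraMap k K) * F

/-- `K` is a Picard-Vessiot extension field of `k` for `δ(Y) = A Y`: the differential field
extension `K / k` has no new constants, and `K` is generated as a field over `k` by the entries of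
a fundamental matrix. -/
structure IsPicardVessiot [DifferentialAlgebra k K] {n : ℕ} (A : Matrix (Fin n) (Fin n) k) :
    Prop where
  constants : Differential.ContainConstants k K
  generated : ∃ F : Matrix (Fin n) (Fin n) K, IsFundamentalMatrix A F ∧
    IntermediateField.adjoin k (Set.range fun p : Fin n × Fin n => F p.1 p.2) = ⊤

variable (k K) in
/-- The differential Galois group `Gal(K/k)`: the field automorphisms of `K` that fix `k`
elementwise and commute with the derivation. -/
def galoisGroup : Subgroup (K ≃ₐ[k] K) where
  carrier := {σ | ∀ x : K, σ (x′) = (σ x)′}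
  mul_mem' := by
    intro σ τ hσ hτ x
    simp only [Set.mem_ofPred_eq] at hσ hτ
    simp [AlgEquiv.mul_apply, hσ, hτ]
  one_mem' := by intro x; simp
  inv_mem' := by
    intro σ hσ x
    simp only [Set.mem_ofPred_eq] at hσ
    apply σ.injective
    rw [hσ, ← AlgEquiv.mul_apply, ← AlgEquiv.mul_apply, mul_inv_cancel]
    simp

end General

section RationalFunctions

variable {C K : Type*} [Field C] [Field K] [Differential K] [Algebra (RatFunc C) K]
  [DifferentialAlgebra (RatFunc C) K] [Algebra C K] [IsScalarTower C (RatFunc C) K]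

variable (K) in
/-- The solution space `V ⊆ K^n` of `δ(Y) = A Y`, a vector space over the constants `C`. -/
def solutionSpace {n : ℕ} (A : Matrix (Fin n) (Fin n) (RatFunc C)) : Submodule C (Fin n → K) where
  carrier := {y | (fun i => (y i)′) = (A.map (algebraMap (RatFunc C) K)).mulVec y}
  add_mem' := by
    intro y z hy hz
    simp only [Set.mem_ofPred_eq] at hy hz ⊢
    rw [Matrix.mulVec_add, ← hy, ← hz]
    ext i
    simp
  zero_mem' := by
    ext i
    simp
  smul_mem' := by
    intro c y hy
    simp only [Set.mem_ofPred_eq] at hy ⊢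
    rw [Matrix.mulVec_smul, ← hy]
    ext i
    have hc : (algebraMap C K c)′ = 0 := by
      rw [IsScalarTower.algebraMap_apply C (RatFunc C) K, deriv_algebraMap,
        RatFunc.deriv_algebraMap_const, map_zero]
    simp [Algebra.smul_def, hc]

/-- The action of the differential Galois group on the solution space, coordinate by coordinate. -/
def galoisRep {n : ℕ} (A : Matrix (Fin n) (Fin n) (RatFunc C)) :
    Representation C (galoisGroup (RatFunc C) K) (solutionSpace K A) where
  toFun σ :=
    { toFun := fun y => ⟨fun i => (σ : K ≃ₐ[RatFunc C] K) ((y : Fin n → K) i), by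
        have hy : (fun i => ((y : Fin n → K) i)′) =
          (A.map (algebraMap (RatFunc C) K)).mulVec (y : Fin n → K) := y.2
        change (fun i => ((σ : K ≃ₐ[RatFunc C] K) ((y : Fin n → K) i))′) = _
        ext i
        rw [← σ.2, congrFun hy i]
        simp [Matrix.mulVec, dotProduct]⟩
      map_add' := by
        intro y z
        ext i
        simp
      map_smul' := by
        intro c y
        ext i
        simp [Algebra.smul_def, IsScalarTower.algebraMap_apply C (RatFunc C) K] }
  map_one' := by
    ext y i
    simp
  map_mul' := by
    intro σ τ
    ext y i
    simp [AlgEquiv.mul_apply]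

/-- `M ∈ GL_n(C(t))` is a defining matrix for the vectors `w_1, …, w_m ∈ K^n`: the `n × m` matrix
`M (w_1, …, w_m)` consists of an invertible `m × m` block on top of a zero block. -/
def IsDefiningMatrix {n m : ℕ} (M : Matrix.GeneralLinearGroup (Fin n) (RatFunc C))
    (w : Fin m → Fin n → K) : Prop :=
  m ≤ n ∧ ∃ T : Matrix.GeneralLinearGroup (Fin m) K, ∀ (i : Fin n) (j : Fin m),
    ((M : Matrix (Fin n) (Fin n) (RatFunc C)).map (algebraMap (RatFunc C) K)).mulVec (w j) i =
      if h : (i : ℕ) < m then (T : Matrix (Fin m) (Fin m) K) ⟨i, h⟩ j else 0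

/-- A `C`-subspace `W` of the solution space is `C(t)`-definable: some (equivalently, by
`IsDefinable.exists_isDefiningMatrix`, every) basis of `W` has a defining matrix. -/
def IsDefinable {n : ℕ} {A : Matrix (Fin n) (Fin n) (RatFunc C)}
    (W : Submodule C (solutionSpace K A)) : Prop :=
  ∃ (m : ℕ) (w : Module.Basis (Fin m) C W) (M : Matrix.GeneralLinearGroup (Fin n) (RatFunc C)),
    IsDefiningMatrix M fun j => ((w j : solutionSpace K A) : Fin n → K)

/-- Definability does not depend on the basis; even the matrix `M` does not. -/
lemma IsDefinable.exists_isDefiningMatrix {n : ℕ} {A : Matrix (Fin n) (Fin n) (RatFunc C)}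
    {W : Submodule C (solutionSpace K A)} (hW : IsDefinable W) :
    ∃ M : Matrix.GeneralLinearGroup (Fin n) (RatFunc C),
      ∀ (m : ℕ) (w : Module.Basis (Fin m) C W),
        IsDefiningMatrix M fun j => ((w j : solutionSpace K A) : Fin n → K) := by
  obtain ⟨m, w, M, hm, T, hT⟩ := hW
  refine ⟨M, fun m' w' => ?_⟩
  obtain rfl : m = m' := by
    have h1 := Module.finrank_eq_card_basis w
    have h2 := Module.finrank_eq_card_basis w'
    simpa using h1.symm.trans h2
  have hinv : IsUnit ((w.toMatrix w').map (algebraMap C K)) := by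
    have h : IsUnit (w.toMatrix w') := by
      rw [Matrix.isUnit_iff_isUnit_det]
      exact IsUnit.of_mul_eq_one _ (by
        rw [← Matrix.det_mul, w.toMatrix_mul_toMatrix_flip w', Matrix.det_one])
    exact h.map (algebraMap C K).mapMatrix
  refine ⟨hm, T * hinv.unit, fun i j => ?_⟩
  have hw : ((w' j : solutionSpace K A) : Fin n → K) =
      ∑ l, w.toMatrix w' l j • ((w l : solutionSpace K A) : Fin n → K) := by
    have h := congrArg ((solutionSpace K A).subtype ∘ₗ W.subtype)
      (w.sum_toMatrix_smul_self w' j)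
    rw [map_sum] at h
    simp only [map_smul] at h
    exact h.symm
  beta_reduce
  rw [hw, Matrix.mulVec_sum, Finset.sum_apply]
  simp only [Matrix.mulVec_smul, Pi.smul_apply, hT]
  split_ifs with h
  · simp [Matrix.mul_apply, Algebra.smul_def, mul_comm]
  · simp

end RationalFunctions

end LinearODE

end

/-! Write `k = C(t)`, and let `U` be the `K`-span of `W` in `K^n`. Solutions independent over `C`
remain independent over `K`, so `W` consists exactly of the solutions lying in `U`
(`mem_of_mem_span`). Definability of `W` amounts to `U` being spanned by vectors over `k`. A matrix
over `k` commutes with the Galois action, so the equations it gives for `U` are Galois invariant;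
this is (a) ⇒ (b). Conversely, if `W` is stable then so is `U`, and Galois descent gives a spanning
set over `k`, provided that the fixed field of the group is `k`.

That fixed field (`exists_mem_galoisGroup_ne`) is the main work. If `x ∉ k`, two embeddings `ι`, `τ`
of `K` agree on `k` but not at `x`; put `Y = ι(F)⁻¹ τ(F)`. The conditions on `Y` that preserve the
algebraic relations of `F` over `k` can be written over the constants, because the ideal they
generate is stable under differentiation of coefficients. The Nullstellensatz then specializes `Y`
to some `c` in `GL_n(C)`, and `F ↦ F c` defines a differential automorphism moving `x`.

The minimal support argument of `Submodule.mem_span_of_coeffwise_stable` serves three times: for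
relations of `F`, for independence over constants, and for Galois descent. -/

/-! ### Descent by minimal support -/

/-- A subspace stable under coefficientwise application of maps `D i` that kill `0` and `1` is
spanned by its vectors whose coefficients are killed by every `D i`. -/
theorem Submodule.mem_span_of_coeffwise_stable {K M S I : Type*} [Field K] [AddCommGroup M]
    [Module K M] (b : Module.Basis S K M) (U : Submodule K M) (D : I → K → K)
    (D_zero : ∀ i, D i 0 = 0) (D_one : ∀ i, D i 1 = 0)
    (stable : ∀ i, ∀ u ∈ U, ∃ v ∈ U, ∀ s, b.repr v s = D i (b.repr u s)) {u : M} (hu : u ∈ U) :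
    u ∈ Submodule.span K {w | w ∈ U ∧ ∀ s i, D i (b.repr w s) = 0} := by
  classical
  induction h : (b.repr u).support.card using Nat.strong_induction_on generalizing u with
  | _ N ih =>
  by_cases hu0 : u = 0
  · exact hu0 ▸ Submodule.zero_mem _
  -- Take a nonzero vector of `U` with smallest support inside that of `u`, scaled to have a
  -- coefficient 1. Each `D i` kills this coefficient and creates no new support, so minimality
  -- forces `D i` to kill all coefficients. Subtracting a multiple of it shrinks the support of `u`.
  -- Additivity of `D i` plays no role, which allows `σ - id` as well as a derivation.
  obtain ⟨w, ⟨hwU, hw0, hwu⟩, hmin⟩ := exists_minimalFor_of_wellFoundedLT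
    (fun w => w ∈ U ∧ w ≠ 0 ∧ (b.repr w).support ⊆ (b.repr u).support)
    (fun w => (b.repr w).support.card) ⟨u, hu, hu0, subset_rfl⟩
  obtain ⟨s, hs⟩ : ∃ s, b.repr w s ≠ 0 := by
    by_contra! hc
    exact hw0 (b.repr.map_eq_zero_iff.1 (Finsupp.ext hc))
  set v := (b.repr w s)⁻¹ • w with hv
  have hvU : v ∈ U := U.smul_mem _ hwU
  have hvs : b.repr v s = 1 := by simp [hv, hs]
  have hvt : ∀ t, b.repr w t = 0 → b.repr v t = 0 := fun t ht => by simp [hv, ht]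
  have hvD : ∀ t i, D i (b.repr v t) = 0 := by
    intro t i
    obtain ⟨v', hv'U, hv'⟩ := stable i v hvU
    suffices v' = 0 by rw [← hv', this]; simp
    by_contra hne
    have hsub : (b.repr v').support ⊆ (b.repr w).support.erase s := by
      intro r hr
      rw [Finsupp.mem_support_iff, hv'] at hr
      rw [Finset.mem_erase, Finsupp.mem_support_iff]
      refine ⟨?_, fun h0 => hr (by rw [hvt r h0, D_zero])⟩
      rintro rfl
      exact hr (by rw [hvs, D_one])
    have hlt : (b.repr v').support.card < (b.repr w).support.card :=
      (Finset.card_le_card hsub).trans_lt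
        (Finset.card_erase_lt_of_mem (Finsupp.mem_support_iff.2 hs))
    exact absurd (hmin ⟨hv'U, hne, (hsub.trans (Finset.erase_subset _ _)).trans hwu⟩ hlt.le)
      (not_le.2 hlt)
  have hsu : s ∈ (b.repr u).support := hwu (Finsupp.mem_support_iff.2 hs)
  have hsub : (b.repr (u - b.repr u s • v)).support ⊆ (b.repr u).support.erase s := by
    intro r hr
    rw [Finsupp.mem_support_iff] at hr
    rw [Finset.mem_erase, Finsupp.mem_support_iff]
    refine ⟨?_, fun h0 => hr ?_⟩
    · rintro rfl
      exact hr (by simp [hvs])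
    · have hw : b.repr w r = 0 := by
        by_contra hc
        exact Finsupp.mem_support_iff.1 (hwu (Finsupp.mem_support_iff.2 hc)) h0
      simp [h0, hvt r hw]
  have hrest := ih _ ((Finset.card_le_card hsub).trans_lt
    ((Finset.card_erase_lt_of_mem hsu).trans_eq h)) (U.sub_mem hu (U.smul_mem _ hvU)) rfl
  have := Submodule.add_mem _ hrest
    (Submodule.smul_mem _ (b.repr u s) (Submodule.subset_span ⟨hvU, hvD⟩))
  simpa using this

-- Separating an element from the base field by two embeddings

universe u v w in
/-- Two field extensions of a field embed into a common field. -/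
theorem Field.exists_amalgam {E : Type u} {K : Type v} {L : Type w} [Field E] [Field K] [Field L]
    (f : E →+* K) (g : E →+* L) :
    ∃ (Ω : Type (max v w)) (_ : Field Ω) (ι : K →+* Ω) (τ : L →+* Ω), ι.comp f = τ.comp g := by
  let _ := f.toAlgebra
  let _ := g.toAlgebra
  obtain ⟨m, hm⟩ := Ideal.exists_maximal (TensorProduct E K L)
  let _ := Ideal.Quotient.field m
  refine ⟨_ ⧸ m, inferInstance,
    (Ideal.Quotient.mk m).comp (Algebra.TensorProduct.includeLeftRingHom),
    (Ideal.Quotient.mk m).comp (Algebra.TensorProduct.includeRight (R := E)).toRingHom, ?_⟩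
  rw [RingHom.comp_assoc, RingHom.comp_assoc]
  congr 1
  ext e
  exact (Algebra.TensorProduct.includeLeft (R := E) (S := E) (A := K) (B := L)).commutes e |>.trans
    ((Algebra.TensorProduct.includeRight (R := E) (A := K) (B := L)).commutes e).symm

open IntermediateField in
/-- In characteristic zero, an element outside the base field can be moved by an embedding of the
simple extension it generates. -/
theorem IntermediateField.exists_algHom_adjoin_simple_ne {k K : Type*} [Field k] [CharZero k]
    [Field K] [Algebra k K] {x : K} (hx : x ∉ (algebraMap k K).range) :
    ∃ ε : k⟮x⟯ →ₐ[k] AlgebraicClosure K,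
      ε (AdjoinSimple.gen k x) ≠ algebraMap K (AlgebraicClosure K) x := by
  by_cases h : IsAlgebraic k x
  -- If every embedding fixed `x` there would be only one, and by separability their number is the
  -- degree.
  · by_contra! hc
    have : FiniteDimensional k k⟮x⟯ := adjoin.finiteDimensional h.isIntegral
    have : Subsingleton (k⟮x⟯ →ₐ[k] AlgebraicClosure K) :=
      ⟨fun σ τ => algHom_ext_of_eq_adjoin _ rfl (by
        rintro y rfl
        exact (hc σ).trans (hc τ).symm)⟩
    have h1 : Module.finrank k k⟮x⟯ ≤ 1 := by
      rw [← AlgHom.card k k⟮x⟯ (AlgebraicClosure K)]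
      exact Fintype.card_le_one_iff_subsingleton.2 this
    have h2 : Module.finrank k k⟮x⟯ = 1 := le_antisymm h1 Module.finrank_pos
    exact hx (mem_bot.1 (finrank_adjoin_simple_eq_one_iff.1 h2))
  -- In the transcendental case the embedding is `x ↦ x + 1`.
  · have ht : Transcendental k x := h
    have ht' : Transcendental k (x + 1) := fun ha => h (by
      simpa using ha.sub (isAlgebraic_one (R := k) (A := K)))
    let e := RatFunc.algEquivOfTranscendental x ht
    refine ⟨(((Algebra.ofId K (AlgebraicClosure K)).restrictScalars k).comp (val _)).comp
      ((RatFunc.algEquivOfTranscendental (x + 1) ht').toAlgHom.comp e.symm.toAlgHom),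
      fun he => ?_⟩
    simp [e] at he

universe u v in
/-- In characteristic zero, every element outside the base field is separated by two embeddings
into a common field. -/
theorem Field.exists_embeddings_ne {k : Type u} {K : Type v} [Field k] [CharZero k]
    [Field K] [Algebra k K] {x : K} (hx : x ∉ (algebraMap k K).range) :
    ∃ (Ω : Type v) (_ : Field Ω) (ι τ : K →+* Ω),
      ι.comp (algebraMap k K) = τ.comp (algebraMap k K) ∧ ι x ≠ τ x := by
  obtain ⟨ε, hε⟩ := IntermediateField.exists_algHom_adjoin_simple_ne hx
  -- Amalgamating over `k(x)` extends `ε` to `τ` on all of `K`, at the price of a larger target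
  -- field.
  obtain ⟨Ω, _, τ, j, h⟩ := Field.exists_amalgam
    (algebraMap (IntermediateField.adjoin k {x}) K) (ε : _ →+* AlgebraicClosure K)
  refine ⟨Ω, inferInstance, j.comp (algebraMap K _), τ, ?_, fun he => ?_⟩
  · ext a
    have := RingHom.congr_fun h (algebraMap k _ a)
    simp only [RingHom.comp_apply, RingHom.coe_coe, AlgHom.commutes] at this ⊢
    rw [← IsScalarTower.algebraMap_apply, ← this, ← IsScalarTower.algebraMap_apply]
  · have := RingHom.congr_fun h (IntermediateField.AdjoinSimple.gen k x)
    simp only [RingHom.comp_apply, RingHom.coe_coe, 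
      IntermediateField.AdjoinSimple.algebraMap_gen] at this he
    exact hε (j.injective (by rw [he, this]))

/-! ### Differentiating the coefficients of polynomials -/

namespace MvPolynomial

section CoeffDeriv

variable {σ K : Type*} [Field K] [Differential K]

/-- The coefficients of `p'` are the derivatives of the coefficients of `p`. -/
def IsCoeffDeriv (p p' : MvPolynomial σ K) : Prop :=
  ∀ m, coeff m p' = (coeff m p)′

theorem IsCoeffDeriv.add {p p' q q' : MvPolynomial σ K} (hp : IsCoeffDeriv p p')
    (hq : IsCoeffDeriv q q') : IsCoeffDeriv (p + q) (p' + q') := fun m => by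
  simp [hp m, hq m]

theorem isCoeffDeriv_zero : IsCoeffDeriv (0 : MvPolynomial σ K) 0 := fun m => by simp

theorem IsCoeffDeriv.sum {ι : Type*} (s : Finset ι) {p p' : ι → MvPolynomial σ K}
    (h : ∀ i ∈ s, IsCoeffDeriv (p i) (p' i)) :
    IsCoeffDeriv (∑ i ∈ s, p i) (∑ i ∈ s, p' i) := fun m => by
  rw [coeff_sum, coeff_sum, map_sum]
  exact Finset.sum_congr rfl fun i hi => h i hi m

theorem IsCoeffDeriv.mul {p p' q q' : MvPolynomial σ K} (hp : IsCoeffDeriv p p')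
    (hq : IsCoeffDeriv q q') : IsCoeffDeriv (p * q) (p' * q + p * q') := fun m => by
  classical
  rw [coeff_add, coeff_mul, coeff_mul, coeff_mul, map_sum, ← Finset.sum_add_distrib]
  refine Finset.sum_congr rfl fun i _ => ?_
  rw [hp, hq, Derivation.leibniz, smul_eq_mul, smul_eq_mul]
  ring

theorem isCoeffDeriv_C (a : K) : IsCoeffDeriv (C a : MvPolynomial σ K) (C (a′)) := fun m => by
  classical
  rw [coeff_C, coeff_C]
  split_ifs <;> simp

theorem isCoeffDeriv_X (i : σ) : IsCoeffDeriv (X i : MvPolynomial σ K) 0 := fun m => by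
  classical
  rw [coeff_X]
  split_ifs <;> simp

theorem IsCoeffDeriv.C_mul {p p' : MvPolynomial σ K} (a : K) (hp : IsCoeffDeriv p p') :
    IsCoeffDeriv (C a * p) (C (a′) * p + C a * p') :=
  (isCoeffDeriv_C a).mul hp

end CoeffDeriv

end MvPolynomial

/-- The entries of a square matrix, as a family indexed by pairs. -/
def Matrix.entries {n R : Type*} (M : Matrix n n R) : n × n → R := fun p => M p.1 p.2

/-! ### Relations of a fundamental matrix under `X = F Y` -/

namespace LinearODE

open MvPolynomial

variable {k K : Type*} [Field k] [Field K] [Algebra k K] {n : ℕ}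

variable (k) in
/-- The substitution `X ↦ F Y` from polynomials over `k` in the entries of `X` to polynomials over
`K` in the entries of `Y`. -/
noncomputable def leftMulSubst (F : Matrix (Fin n) (Fin n) K) :
    MvPolynomial (Fin n × Fin n) k →ₐ[k] MvPolynomial (Fin n × Fin n) K :=
  aeval (F.map C * Matrix.mvPolynomialX (Fin n) (Fin n) K).entries

theorem leftMulSubst_X (F : Matrix (Fin n) (Fin n) K) (i j : Fin n) :
    leftMulSubst k F (X (i, j)) = ∑ l, C (F i l) * X (l, j) := by
  simp [leftMulSubst, Matrix.entries, Matrix.mul_apply]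

theorem leftMulSubst_C (F : Matrix (Fin n) (Fin n) K) (a : k) :
    leftMulSubst k F (C a) = C (algebraMap k K a) := by
  rw [leftMulSubst, aeval_C]
  rfl

/-- Evaluating `f(F Y)` at `Y = N` gives `f(F N)`. -/
theorem eval₂_leftMulSubst {Ω : Type*} [CommRing Ω] (ι : K →+* Ω) (F : Matrix (Fin n) (Fin n) K)
    (N : Matrix (Fin n) (Fin n) Ω) (f : MvPolynomial (Fin n × Fin n) k) :
    eval₂ ι N.entries (leftMulSubst k F f) =
      eval₂ (ι.comp (algebraMap k K)) (F.map ι * N).entries f := by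
  have : ((eval₂Hom ι N.entries).comp (leftMulSubst k F : _ →+* MvPolynomial _ K)) =
      eval₂Hom (ι.comp (algebraMap k K)) (F.map ι * N).entries := by
    ext p
    · simp
    · obtain ⟨i, j⟩ := p
      simp [leftMulSubst_X, Matrix.entries, Matrix.mul_apply]
  exact RingHom.congr_fun this f

variable [Differential k] [Differential K] [DifferentialAlgebra k K]

/-- With `Y` treated as constant, `(F Y)′ = A (F Y)`. Thus `g` is the image of `f` under the
derivation of `k[X]` extending that of `k` with `X′ = A X`. The second conclusion shows that `g`
vanishes at `F` whenever `f` does. -/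
theorem exists_isCoeffDeriv_leftMulSubst {A : Matrix (Fin n) (Fin n) k}
    {F : Matrix (Fin n) (Fin n) K} (hF : IsFundamentalMatrix A F)
    (f : MvPolynomial (Fin n × Fin n) k) :
    ∃ g, IsCoeffDeriv (leftMulSubst k F f) (leftMulSubst k F g) ∧
      (aeval F.entries f)′ = aeval F.entries g := by
  have hd : ∀ i j, (F i j)′ = ∑ l, algebraMap k K (A i l) * F l j := fun i j => by
    simpa [Matrix.mul_apply] using congrFun (congrFun hF.2 i) j
  induction f using MvPolynomial.induction_on with
  | C a =>
    refine ⟨C (a′), ?_, ?_⟩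
    · rw [leftMulSubst_C, leftMulSubst_C, ← deriv_algebraMap]
      exact isCoeffDeriv_C _
    · simp [deriv_algebraMap]
  | add p q hp hq =>
    obtain ⟨p', hp1, hp2⟩ := hp
    obtain ⟨q', hq1, hq2⟩ := hq
    exact ⟨p' + q', by simpa using hp1.add hq1, by simp [hp2, hq2]⟩
  | mul_X p ij hp =>
    obtain ⟨p', hp1, hp2⟩ := hp
    obtain ⟨i, j⟩ := ij
    refine ⟨p' * X (i, j) + p * ∑ l, C (A i l) * X (l, j), ?_, ?_⟩
    · rw [map_mul, map_add, map_mul, map_mul]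
      refine hp1.mul ?_
      have h1 : leftMulSubst k F (∑ l, C (A i l) * X (l, j)) =
          ∑ l, (C ((F i l)′) * X (l, j) + C (F i l) * 0) := by
        simp only [map_sum, map_mul, leftMulSubst_C, leftMulSubst_X, hd, Finset.sum_mul,
          Finset.mul_sum, mul_zero, add_zero, mul_assoc]
        exact Finset.sum_comm
      rw [h1, leftMulSubst_X]
      exact IsCoeffDeriv.sum _ fun l _ => (isCoeffDeriv_X _).C_mul _
    · have h1 : aeval F.entries (X (i, j) : MvPolynomial _ k) = F i j := by simp [Matrix.entries]
      have h2 : aeval F.entries (∑ l, C (A i l) * X (l, j) : MvPolynomial _ k) = (F i j)′ := by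
        simp [hd, Matrix.entries]
      rw [map_mul (aeval F.entries), Derivation.leibniz, map_add, map_mul (aeval F.entries),
        map_mul (aeval F.entries), h1, h2, hp2, smul_eq_mul, smul_eq_mul]
      ring

/-- The `K`-span of the relations `f(F Y)`, for the polynomials `f` over `k` vanishing at `F`, is
spanned by polynomials with constant coefficients. -/
theorem leftMulSubst_mem_span_const {A : Matrix (Fin n) (Fin n) k}
    {F : Matrix (Fin n) (Fin n) K} (hF : IsFundamentalMatrix A F)
    {u : MvPolynomial (Fin n × Fin n) K}
    (hu : u ∈ Submodule.span K (leftMulSubst k F '' {f | aeval F.entries f = 0})) :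
    u ∈ Submodule.span K
      {w | w ∈ Submodule.span K (leftMulSubst k F '' {f | aeval F.entries f = 0}) ∧
        ∀ m, (coeff m w)′ = 0} := by
  have := Submodule.mem_span_of_coeffwise_stable (I := Unit) (basisMonomials (Fin n × Fin n) K)
    (Submodule.span K (leftMulSubst k F '' {f | aeval F.entries f = 0}))
    (fun _ x => x′) (by simp) (by simp) (fun _ u hu => ?_) hu
  · refine Submodule.span_mono ?_ this
    exact fun w hw => ⟨hw.1, fun m => hw.2 m ()⟩
  · suffices ∃ v ∈ Submodule.span K (leftMulSubst k F '' {f | aeval F.entries f = 0}),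
        IsCoeffDeriv u v from this
    induction hu using Submodule.span_induction with
    | mem x hx =>
      obtain ⟨f, hf, rfl⟩ := hx
      obtain ⟨g, hg, hg'⟩ := exists_isCoeffDeriv_leftMulSubst hF f
      refine ⟨_, Submodule.subset_span ⟨g, ?_, rfl⟩, hg⟩
      rw [Set.mem_ofPred_eq] at hf ⊢
      rw [← hg', hf, map_zero]
    | zero => exact ⟨0, Submodule.zero_mem _, isCoeffDeriv_zero⟩
    | add x y _ _ hx hy =>
      obtain ⟨x', hx', hx⟩ := hx
      obtain ⟨y', hy', hy⟩ := hy
      exact ⟨_, Submodule.add_mem _ hx' hy', hx.add hy⟩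
    | smul a x hxU hx =>
      obtain ⟨x', hx', hx⟩ := hx
      refine ⟨_, Submodule.add_mem _ (Submodule.smul_mem _ (a′) hxU) (Submodule.smul_mem _ a hx'),
        ?_⟩
      simpa only [smul_eq_C_mul] using hx.C_mul a

end LinearODE

/-! ### Specialization to points over the constants -/

/-- A sum of products `ι (g j) * y j` vanishes if it vanishes after applying every `C`-linear
functional to the coefficients `g j`. -/
theorem Finset.sum_ringHom_mul_eq_zero_of_dual {C K Ω J : Type*} [Field C] [Field K] [Algebra C K]
    [CommRing Ω] (ι : K →+* Ω) (s : Finset J) (g : J → K) (y : J → Ω)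
    (h : ∀ l : K →ₗ[C] C, ∑ j ∈ s, ι (algebraMap C K (l (g j))) * y j = 0) :
    ∑ j ∈ s, ι (g j) * y j = 0 := by
  classical
  -- Expand the `g j` in a `C`-basis of `K`; the contribution of each basis vector vanishes by the
  -- hypothesis for its coordinate functional.
  let b := Module.Basis.ofVectorSpace C K
  let T := s.biUnion fun j => (b.repr (g j)).support
  have hg : ∀ j ∈ s, g j = ∑ i ∈ T, algebraMap C K (b.repr (g j) i) * b i := fun j hj => by
    conv_lhs => rw [← b.linearCombination_repr (g j), Finsupp.linearCombination_apply]
    rw [Finsupp.sum_of_support_subset _ (Finset.subset_biUnion_of_mem (fun j => (b.repr (g j)).support) hj) _ (by simp)]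
    simp only [Algebra.smul_def, T]
  calc ∑ j ∈ s, ι (g j) * y j
      = ∑ j ∈ s, ∑ i ∈ T, ι (b i) * (ι (algebraMap C K (b.coord i (g j))) * y j) := by
        refine Finset.sum_congr rfl fun j hj => ?_
        conv_lhs => rw [hg j hj]
        rw [map_sum, Finset.sum_mul]
        refine Finset.sum_congr rfl fun i _ => ?_
        rw [map_mul, Module.Basis.coord_apply]
        ring
    _ = 0 := by
        rw [Finset.sum_comm]
        refine Finset.sum_eq_zero fun i _ => ?_
        rw [← Finset.mul_sum, h (b.coord i), mul_zero]

/-- A form of the Nullstellensatz: if a polynomial `g` over an extension `K` of an algebraically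
closed field `C` does not vanish at a point `y` of a domain containing `K`, then `y` specializes
over `C` to a point with coordinates in `C` at which `g` does not vanish. -/
theorem MvPolynomial.exists_specialization_eval_ne_zero {C K Ω σ : Type*} [Field C] [IsAlgClosed C]
    [Field K] [Algebra C K] [Field Ω] [Finite σ] (ι : K →+* Ω) (y : σ → Ω) (s : MvPolynomial σ C)
    (hs : eval₂ (ι.comp (algebraMap C K)) y s ≠ 0) (g : MvPolynomial σ K)
    (hg : eval₂ ι y g ≠ 0) :
    ∃ c : σ → C, (∀ h : MvPolynomial σ C, eval₂ (ι.comp (algebraMap C K)) y h = 0 → eval c h = 0) ∧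
      eval c s ≠ 0 ∧ eval (fun i => algebraMap C K (c i)) g ≠ 0 := by
  -- Suppose `g` vanishes at every `C`-point `c` of the zero set of `Q` with `s(c) ≠ 0`. For a
  -- functional `l`, applying `l` to the coefficients of `g` gives `gl` with `gl(c) = l(g(c)) = 0`.
  -- So `s * gl` vanishes on that zero set and lies in the prime `Q`, while `s` does not. Hence
  -- `gl(y) = 0` for all `l`, which forces `g(y) = 0`.
  by_contra! hc
  let Q : Ideal (MvPolynomial σ C) := RingHom.ker (eval₂Hom (ι.comp (algebraMap C K)) y)
  have hQ : Q.IsPrime := RingHom.ker_isPrime _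
  have hQv : ∀ p : MvPolynomial σ C,
      (∀ c : σ → C, (∀ h ∈ Q, eval c h = 0) → eval c p = 0) → p ∈ Q := by
    intro p hp
    rw [← hQ.radical, ← vanishingIdeal_zeroLocus_eq_radical (K := C) Q]
    intro c hcQ
    simpa [coe_aeval_eq_eval] using hp c fun h hh => by simpa [coe_aeval_eq_eval] using hcQ h hh
  refine hg ?_
  rw [eval₂_eq]
  refine Finset.sum_ringHom_mul_eq_zero_of_dual (C := C) ι _ _ _ fun l => ?_
  let gl : MvPolynomial σ C := ∑ m ∈ g.support, monomial m (l (coeff m g))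
  have hgl : s * gl ∈ Q := by
    refine hQv _ fun c hcQ => ?_
    rw [map_mul, mul_eq_zero, or_iff_not_imp_left]
    intro hsc
    have h0 := hc c hcQ hsc
    rw [eval_eq] at h0
    have := congrArg l h0
    rw [map_sum, map_zero] at this
    rw [map_sum, ← this]
    refine Finset.sum_congr rfl fun m _ => ?_
    rw [eval_monomial, mul_comm (l _), ← smul_eq_mul, ← map_smul, Algebra.smul_def, mul_comm]
    simp [Finsupp.prod]
  have := (hQ.mem_or_mem hgl).resolve_left hs
  rw [RingHom.mem_ker, map_sum] at this
  rw [← this]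
  refine Finset.sum_congr rfl fun m _ => ?_
  rw [coe_eval₂Hom, eval₂_monomial]
  rfl

/-! ### A constant matrix that respects the relations and moves `x` -/

namespace LinearODE
open MvPolynomial

/-- For an element `x` outside `k`, some invertible constant matrix `c` respects the relations
satisfied by `F` but not the presentation of `x` as a quotient of polynomials in `F`. -/
theorem exists_constant_matrix {C k K : Type*} [Field C] [IsAlgClosed C] [Field k] [CharZero k]
    [Field K] [Algebra k K] [Algebra C K] [Differential k] [Differential K]
    [DifferentialAlgebra k K]
    (hconst : ∀ x : K, x′ = 0 → x ∈ (algebraMap C K).range)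
    {n : ℕ} {A : Matrix (Fin n) (Fin n) k} {F : Matrix (Fin n) (Fin n) K}
    (hF : IsFundamentalMatrix A F) {x : K} (hx : x ∉ (algebraMap k K).range)
    {a b : MvPolynomial (Fin n × Fin n) k} (hb : aeval F.entries b ≠ 0)
    (hab : x * aeval F.entries b = aeval F.entries a) :
    ∃ c : Matrix (Fin n) (Fin n) C, c.det ≠ 0 ∧
      (∀ f : MvPolynomial (Fin n × Fin n) k, aeval F.entries f = 0 →
        aeval (F * c.map (algebraMap C K)).entries f = 0) ∧
      x * aeval (F * c.map (algebraMap C K)).entries b ≠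
        aeval (F * c.map (algebraMap C K)).entries a := by
  obtain ⟨Ω, _, ι, τ, hιτ, hne⟩ := Field.exists_embeddings_ne hx
  have hFdet : F.det ≠ 0 := ((Matrix.isUnit_iff_isUnit_det F).1 hF.1).ne_zero
  let Y : Matrix (Fin n) (Fin n) Ω := F⁻¹.map ι * F.map τ
  have hFY : F.map ι * Y = F.map τ := by
    rw [← mul_assoc, ← Matrix.map_mul, Matrix.mul_nonsing_inv _ (isUnit_iff_ne_zero.2 hFdet),
      Matrix.map_one ι (map_zero _) (map_one _), one_mul]
  have hYdet : Y.det ≠ 0 := by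
    intro h
    have := congrArg Matrix.det hFY
    rw [Matrix.det_mul, h, mul_zero] at this
    exact hFdet (τ.injective (by rw [map_zero, this]; exact RingHom.map_det τ F))
  have hτ : ∀ f : MvPolynomial (Fin n × Fin n) k,
      eval₂ ι Y.entries (leftMulSubst k F f) = τ (aeval F.entries f) := fun f => by
    rw [eval₂_leftMulSubst, hFY, hιτ, aeval_def, eval₂_comp_left]
    rfl
  have hc : ∀ (c : Matrix (Fin n) (Fin n) C) (f : MvPolynomial (Fin n × Fin n) k),
      eval (fun p => algebraMap C K (c.entries p)) (leftMulSubst k F f) =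
        aeval (F * c.map (algebraMap C K)).entries f := fun c f => by
    have := eval₂_leftMulSubst (RingHom.id K) F (c.map (algebraMap C K)) f
    rwa [RingHom.id_comp] at this
  -- The determinant keeps `c` invertible. The second polynomial, `x b(F Y) - a(F Y)`, takes at `Y`
  -- the value `(ι x - τ x) τ(b(F))`, which is nonzero.
  obtain ⟨c, hc1, hc2, hc3⟩ := exists_specialization_eval_ne_zero (C := C) ι Y.entries
    (Matrix.mvPolynomialX (Fin n) (Fin n) C).det (by
      rw [← coe_eval₂Hom, RingHom.map_det, RingHom.mapMatrix_apply, coe_eval₂Hom]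
      exact (congrArg Matrix.det (Matrix.mvPolynomialX_map_eval₂ _ Y)).trans_ne hYdet) (MvPolynomial.C x * leftMulSubst k F b - leftMulSubst k F a) (by
      rw [eval₂_sub, eval₂_mul, eval₂_C, hτ, hτ, ← hab, map_mul τ, ← sub_mul]
      exact mul_ne_zero (sub_ne_zero.2 hne) (by rwa [Ne, map_eq_zero]))
  rw [Matrix.eval_det_mvPolynomialX] at hc2
  have hce : (Matrix.of fun i j => c (i, j)).entries = c := rfl
  refine ⟨Matrix.of fun i j => c (i, j), hc2, fun f hf => ?_, ?_⟩
  · rw [← hc, hce]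
    -- The relation `f(F Y)` is a `K`-combination of polynomials over `C` that vanish at `Y`; these
    -- are the relations that pass to the specialization `c`.
    have hu := leftMulSubst_mem_span_const hF (Submodule.subset_span ⟨f, hf, rfl⟩)
    generalize leftMulSubst k F f = u at hu
    induction hu using Submodule.span_induction with
    | zero => simp
    | add u v _ _ hu hv => rw [map_add, hu, hv, add_zero]
    | smul r u _ hu => rw [smul_eq_C_mul, map_mul, hu, mul_zero]
    | mem w hw =>
      obtain ⟨hwU, hwc⟩ := hw
      obtain ⟨h, rfl⟩ : w ∈ Set.range (map (algebraMap C K)) := by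
        rw [mem_range_map_iff_coeffs_subset]
        intro r hr
        obtain ⟨m, -, rfl⟩ := mem_coeffs_iff.1 hr
        exact hconst _ (hwc m)
      have hw0 : eval₂ ι Y.entries (map (algebraMap C K) h) = 0 := by
        generalize map (algebraMap C K) h = w at hwU
        induction hwU using Submodule.span_induction with
        | zero => simp
        | add u v _ _ hu hv => rw [eval₂_add, hu, hv, add_zero]
        | smul r u _ hu => rw [smul_eq_C_mul, eval₂_mul, hu, mul_zero]
        | mem w hw =>
          obtain ⟨f, hf, rfl⟩ := hw
          rw [hτ, show aeval F.entries f = 0 from hf, map_zero]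
      rw [eval₂_map] at hw0
      have := hc1 h hw0
      rw [eval_map]
      have hev := (eval₂_comp (algebraMap C K) c h).symm
      rw [this, map_zero] at hev
      exact hev
  · rw [← hc, ← hc, hce]
    intro h
    exact hc3 (by rw [map_sub, map_mul, eval_C, h, sub_self])

end LinearODE

/-! ### From the constant matrix to a differential automorphism -/

/-- A surjective endomorphism of a Noetherian ring that maps an ideal into itself maps no other
element into it. -/
theorem Ideal.eq_comap_of_le_comap_of_surjective {R : Type*} [CommRing R] [IsNoetherianRing R]
    {θ : R →+* R} (hθ : Function.Surjective θ) {I : Ideal R} (h : I ≤ I.comap θ) :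
    I = I.comap θ := by
  -- The iterated preimages of `I` form an ascending chain. Once it stabilizes, injectivity of
  -- `Ideal.comap θ` cancels the iterations.
  have hmono : Monotone fun m : ℕ => (Ideal.comap θ)^[m] I := by
    refine monotone_nat_of_le_succ fun m => ?_
    rw [Function.iterate_succ_apply]
    exact Monotone.iterate (fun _ _ h => Ideal.comap_mono h) m h
  obtain ⟨m, hm⟩ := monotone_stabilizes_iff_noetherian.2 ‹_› ⟨_, hmono⟩
  refine (Ideal.comap_injective_of_surjective θ hθ).iterate m ?_
  rw [← Function.iterate_succ_apply]
  exact hm (m + 1) m.le_succ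

namespace LinearODE
open MvPolynomial

variable {k K : Type*} [Field k] [Field K] [Algebra k K]

/-- The substitution `X ↦ X c` is surjective for an invertible matrix `c`. -/
theorem surjective_aeval_mul_right {n : ℕ} {c : Matrix (Fin n) (Fin n) k} (hc : IsUnit c.det) :
    Function.Surjective (aeval (R := k)
      (Matrix.mvPolynomialX (Fin n) (Fin n) k * c.map MvPolynomial.C).entries) := by
  intro f
  refine ⟨aeval (Matrix.mvPolynomialX (Fin n) (Fin n) k * c⁻¹.map MvPolynomial.C).entries f, ?_⟩
  rw [← AlgHom.comp_apply]
  refine (AlgHom.congr_fun (MvPolynomial.algHom_ext fun p => ?_) f).trans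
    (AlgHom.id_apply (R := k) f)
  obtain ⟨i, j⟩ := p
  have h : (Matrix.mvPolynomialX (Fin n) (Fin n) k * c.map MvPolynomial.C) *
      c⁻¹.map MvPolynomial.C = Matrix.mvPolynomialX (Fin n) (Fin n) k := by
    rw [mul_assoc, ← Matrix.map_mul, Matrix.mul_nonsing_inv _ hc,
      Matrix.map_one _ (map_zero _) (map_one _), mul_one]
  have h' := congrFun (congrFun h i) j
  rw [Matrix.mul_apply] at h'
  simpa [Matrix.entries, Matrix.mul_apply (M := Matrix.mvPolynomialX (Fin n) (Fin n) k)
    (N := c⁻¹.map MvPolynomial.C)] using h'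

/-- If the relations satisfied by `F` are satisfied by `F c`, the converse holds as well. -/
theorem aeval_eq_zero_of_aeval_mul_right {n : ℕ} {F : Matrix (Fin n) (Fin n) K}
    {c : Matrix (Fin n) (Fin n) k} (hc : IsUnit c.det)
    (h : ∀ f : MvPolynomial (Fin n × Fin n) k, aeval F.entries f = 0 →
      aeval (F * c.map (algebraMap k K)).entries f = 0)
    {f : MvPolynomial (Fin n × Fin n) k}
    (hf : aeval (F * c.map (algebraMap k K)).entries f = 0) : aeval F.entries f = 0 := by
  let θ : MvPolynomial (Fin n × Fin n) k →ₐ[k] MvPolynomial (Fin n × Fin n) k :=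
    aeval (Matrix.mvPolynomialX (Fin n) (Fin n) k * c.map MvPolynomial.C).entries
  have hθ : (aeval F.entries).comp θ = aeval (R := k) (F * c.map (algebraMap k K)).entries := by
    ext p
    simp [θ, Matrix.entries, Matrix.mul_apply]
  have key := Ideal.eq_comap_of_le_comap_of_surjective (θ := (θ : _ →+* MvPolynomial _ k))
    (surjective_aeval_mul_right hc)
    (I := RingHom.ker (aeval (R := k) F.entries)) (fun f hf => by
      rw [Ideal.mem_comap, RingHom.mem_ker]
      exact (AlgHom.congr_fun hθ f).trans (h f hf))
  have : f ∈ RingHom.ker (aeval (R := k) F.entries) := by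
    rw [key, Ideal.mem_comap, RingHom.mem_ker]
    exact (AlgHom.congr_fun hθ f).trans hf
  exact this

/-- A matrix `G` satisfying the same relations as generators `F` of `K` is the image of `F` under a
field endomorphism. -/
theorem exists_algHom_of_same_relations {σ : Type*} {F G : σ → K}
    (hgen : IntermediateField.adjoin k (Set.range F) = ⊤)
    (h : ∀ f : MvPolynomial σ k, aeval F f = 0 ↔ aeval G f = 0) :
    ∃ φ : K →ₐ[k] K, ∀ i, φ (F i) = G i := by
  -- `B` is `k[F]`, whose fraction field is `K` as `F` generates it; the injection `F ↦ G` therefore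
  -- extends to `K`.
  let B := MvPolynomial σ k ⧸ RingHom.ker (aeval (R := k) F)
  let jF : B →ₐ[k] K := Ideal.Quotient.liftₐ _ (aeval (R := k) F) fun f hf => hf
  let jG : B →ₐ[k] K := Ideal.Quotient.liftₐ _ (aeval (R := k) G) fun f hf => (h f).1 hf
  have hjF : ∀ f, jF (Ideal.Quotient.mk _ f) = aeval F f := fun f => rfl
  have hjG : ∀ f, jG (Ideal.Quotient.mk _ f) = aeval G f := fun f => rfl
  have hF : Function.Injective jF := (injective_iff_map_eq_zero _).2 fun y hy => by
    obtain ⟨f, rfl⟩ := Ideal.Quotient.mk_surjective y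
    exact Ideal.Quotient.eq_zero_iff_mem.2 (by rwa [hjF] at hy)
  have hG : Function.Injective jG := (injective_iff_map_eq_zero _).2 fun y hy => by
    obtain ⟨f, rfl⟩ := Ideal.Quotient.mk_surjective y
    exact Ideal.Quotient.eq_zero_iff_mem.2 ((h f).2 (by rwa [hjG] at hy))
  let _ : Algebra B K := jF.toRingHom.toAlgebra
  have : IsScalarTower k B K := .of_algebraMap_eq fun a => (jF.commutes a).symm
  have : FaithfulSMul B K := (faithfulSMul_iff_algebraMap_injective B K).2 hF
  have : IsFractionRing B K := .of_field _ _ fun z => by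
    obtain ⟨r, s, rfl⟩ := (IntermediateField.mem_adjoin_range_iff k F z).1
      (hgen ▸ IntermediateField.mem_top)
    exact ⟨Ideal.Quotient.mk _ r, Ideal.Quotient.mk _ s, rfl⟩
  refine ⟨IsFractionRing.liftAlgHom hG, fun i => ?_⟩
  have := IsFractionRing.lift_algebraMap (K := K) hG (Ideal.Quotient.mk _ (X i))
  have h1 : algebraMap B K (Ideal.Quotient.mk _ (X i)) = F i := (hjF _).trans (aeval_X _ _)
  rw [h1] at this
  exact this.trans ((hjG _).trans (aeval_X _ _))

/-- An endomorphism over `k` that commutes with the derivation on generators commutes with it. -/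
theorem algHom_map_deriv_of_generators [Differential k] [Differential K] [DifferentialAlgebra k K]
    {S : Set K} (hgen : IntermediateField.adjoin k S = ⊤) (φ : K →ₐ[k] K)
    (h : ∀ z ∈ S, φ (z′) = (φ z)′) (z : K) : φ (z′) = (φ z)′ := by
  have hz : z ∈ IntermediateField.adjoin k S := hgen ▸ IntermediateField.mem_top
  induction hz using IntermediateField.adjoin_induction with
  | mem z hz => exact h z hz
  | algebraMap a => rw [deriv_algebraMap, AlgHom.commutes, AlgHom.commutes, deriv_algebraMap]
  | add y z _ _ hy hz => simp only [map_add, hy, hz]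
  | mul y z _ _ hy hz => simp only [map_add, map_mul, Derivation.leibniz, smul_eq_mul, hy, hz]
  | inv z _ hz => simp only [map_inv₀, Derivation.leibniz_inv, smul_eq_mul, map_mul, map_neg,
      map_pow, hz]

/-- Elements of `K` outside `k` are moved by the differential Galois group. -/
theorem exists_mem_galoisGroup_ne {C : Type*} [Field C] [IsAlgClosed C] [CharZero k]
    [Algebra C k] [Algebra C K] [IsScalarTower C k K]
    [Differential k] [Differential K] [DifferentialAlgebra k K]
    (hC : ∀ c : C, (algebraMap C K c)′ = 0)
    (hconst : ∀ x : K, x′ = 0 → x ∈ (algebraMap C K).range)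
    {n : ℕ} {A : Matrix (Fin n) (Fin n) k} {F : Matrix (Fin n) (Fin n) K}
    (hF : IsFundamentalMatrix A F)
    (hgen : IntermediateField.adjoin k (Set.range F.entries) = ⊤)
    {x : K} (hx : x ∉ (algebraMap k K).range) :
    ∃ σ ∈ galoisGroup k K, σ x ≠ x := by
  obtain ⟨a, b, hab⟩ := (IntermediateField.mem_adjoin_range_iff k F.entries x).1
      (hgen ▸ IntermediateField.mem_top)
  -- A zero denominator would make `x` equal to 0 by the convention for division, hence an element
  -- of `k`.
  have hb : aeval F.entries b ≠ 0 := fun h0 => hx ⟨0, by rw [hab, h0, div_zero, map_zero]⟩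
  have hab' : x * aeval F.entries b = aeval F.entries a := by rw [hab, div_mul_cancel₀ _ hb]
  obtain ⟨c, hc, hrel, hne⟩ := exists_constant_matrix hconst hF hx hb hab'
  set c' := c.map (algebraMap C k) with hc'
  have hcc' : c.map (algebraMap C K) = c'.map (algebraMap k K) := by
    ext i j
    simp [hc', IsScalarTower.algebraMap_apply C k K]
  have hcu : IsUnit c'.det := by
    have : c'.det = algebraMap C k c.det := (RingHom.map_det (algebraMap C k) c).symm
    rw [this]
    exact (isUnit_iff_ne_zero.2 hc).map _
  obtain ⟨φ, hφ⟩ := exists_algHom_of_same_relations hgen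
    (G := (F * c.map (algebraMap C K)).entries) fun f => ⟨hrel f, fun h0 => by
      rw [hcc'] at h0 hrel
      exact aeval_eq_zero_of_aeval_mul_right hcu hrel h0⟩
  have hφF : F.map φ = F * c.map (algebraMap C K) := by
    ext i j
    exact hφ (i, j)
  -- The image contains `k` and `F = φ(F) c⁻¹`.
  have hφs : Function.Surjective φ := by
    rw [← AlgHom.fieldRange_eq_top, ← top_le_iff, ← hgen, IntermediateField.adjoin_le_iff]
    rintro _ ⟨⟨i, j⟩, rfl⟩
    have h : F = F.map φ * c'⁻¹.map (algebraMap k K) := by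
      rw [hφF, hcc', mul_assoc, ← Matrix.map_mul, Matrix.mul_nonsing_inv _ hcu,
        Matrix.map_one _ (map_zero _) (map_one _), mul_one]
    have hij : F.entries (i, j) = _ := congrFun (congrFun h i) j
    rw [hij, Matrix.mul_apply]
    exact sum_mem fun l _ => mul_mem ⟨F i l, rfl⟩ (IntermediateField.algebraMap_mem _ _)
  -- On generators this is `(F c)′ = A F c`, valid because `c` is constant.
  have hφd : ∀ z : K, φ (z′) = (φ z)′ := by
    refine algHom_map_deriv_of_generators hgen φ ?_
    rintro _ ⟨⟨i, j⟩, rfl⟩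
    have hd : ∀ i j, (F i j)′ = ∑ l, algebraMap k K (A i l) * F l j := fun i j => by
      simpa [Matrix.mul_apply] using congrFun (congrFun hF.2 i) j
    rw [hφ]
    simp only [Matrix.entries, Matrix.mul_apply, Matrix.map_apply, map_sum, Derivation.leibniz,
      hC, smul_eq_mul, mul_zero, zero_add, hd, map_mul, AlgHom.commutes]
    have hφ' : ∀ i j, φ (F i j) = ∑ l, F i l * algebraMap C K (c l j) := fun i j => by
      simpa [Matrix.entries, Matrix.mul_apply] using hφ (i, j)
    simp only [hφ', Finset.mul_sum]
    rw [Finset.sum_comm]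
    refine Finset.sum_congr rfl fun l _ => Finset.sum_congr rfl fun m _ => ?_
    ring
  -- If `φ` fixed `x`, applying it to `x b(F) = a(F)` would give `x b(F c) = a(F c)`, which `hne`
  -- excludes.
  refine ⟨AlgEquiv.ofBijective φ ⟨φ.toRingHom.injective, hφs⟩, hφd, fun hfix => hne ?_⟩
  have hfix : φ x = x := hfix
  have hev : ∀ f : MvPolynomial (Fin n × Fin n) k,
      φ (aeval F.entries f) = aeval (F * c.map (algebraMap C K)).entries f := fun f => by
    rw [← AlgHom.comp_apply]
    refine AlgHom.congr_fun (MvPolynomial.algHom_ext fun p => ?_) f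
    simp [hφ]
  rw [← hev, ← hev, ← hab', map_mul, hfix]

end LinearODE

/-! ### Constants of `C(t)` and adapted bases -/

/-- For a reduced fraction `p / q`, the equation `p′ q = p q′` and coprimality give `q ∣ q′`. By
degree `q′ = 0`, and then `p′ = 0`; in characteristic zero both are constants. -/
theorem RatFunc.mem_range_of_ddt_eq_zero {C : Type*} [Field C] [CharZero C] {f : RatFunc C}
    (hf : f′ = 0) : f ∈ (algebraMap C (RatFunc C)).range := by
  have hd : f.denom ≠ 0 := f.denom_ne_zero
  have h1 : Polynomial.derivative f.num * f.denom = f.num * Polynomial.derivative f.denom := by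
    have h : RatFunc.ddtFun f = 0 := hf
    rw [RatFunc.ddtFun, div_eq_zero_iff, or_iff_left (pow_ne_zero 2 (algebraMap_ne_zero hd))] at h
    exact sub_eq_zero.1 (algebraMap_injective C (h.trans (map_zero _).symm))
  have h2 : f.denom ∣ Polynomial.derivative f.denom :=
    f.isCoprime_num_denom.symm.dvd_of_dvd_mul_left (Dvd.intro_left _ h1)
  have h3 : Polynomial.derivative f.denom = 0 := by
    by_contra hne
    exact absurd (Polynomial.degree_le_of_dvd h2 hne)
      (not_le.2 (Polynomial.degree_derivative_lt hd))
  have h4 : Polynomial.derivative f.num = 0 := by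
    rw [h3, mul_zero] at h1
    exact (mul_eq_zero.1 h1).resolve_right hd
  rw [← f.num_div_denom, Polynomial.eq_C_of_derivative_eq_zero h3,
    Polynomial.eq_C_of_derivative_eq_zero h4]
  exact ⟨f.num.coeff 0 / f.denom.coeff 0, by
    rw [map_div₀, algebraMap_C, algebraMap_C, algebraMap_eq_C]⟩

/-- A subspace of `k ^ n` has a basis that some invertible matrix maps to the first standard basis
vectors. -/
theorem Submodule.exists_generalLinearGroup_mulVec_basis {k : Type*} [Field k] {n : ℕ}
    (U : Submodule k (Fin n → k)) :
    ∃ (d : ℕ) (hd : d ≤ n) (u : Module.Basis (Fin d) k U) (M : Matrix.GeneralLinearGroup (Fin n) k),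
      ∀ l, (M : Matrix (Fin n) (Fin n) k).mulVec (u l) = Pi.single (Fin.castLE hd l) 1 := by
  obtain ⟨U', hU⟩ := U.exists_isCompl
  let u := Module.finBasis k U
  -- A basis of `U` followed by one of a complement; `M` is the coordinate map of this basis.
  let b₀ := (u.prod (Module.finBasis k U')).map (Submodule.prodEquivOfIsCompl U U' hU)
  have hn : Module.finrank k U + Module.finrank k U' = n := by
    rw [Submodule.finrank_add_eq_of_isCompl hU, Module.finrank_fin_fun]
  have hd : Module.finrank k U ≤ n := (Nat.le_add_right _ _).trans_eq hn
  let e := finSumFinEquiv.trans (finCongr hn)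
  let b : Module.Basis (Fin n) k (Fin n → k) := b₀.reindex e
  refine ⟨_, hd, u,
    ⟨LinearMap.toMatrix' (b.equivFun : _ →ₗ[k] _), LinearMap.toMatrix' (b.equivFun.symm : _ →ₗ[k] _),
      ?_, ?_⟩, fun l => ?_⟩
  · rw [← LinearMap.toMatrix'_comp, LinearEquiv.comp_symm, LinearMap.toMatrix'_id]
  · rw [← LinearMap.toMatrix'_comp, LinearEquiv.symm_comp, LinearMap.toMatrix'_id]
  · have h : (u l : Fin n → k) = b (e (Sum.inl l)) := by
      simp [b, b₀]
    rw [LinearMap.toMatrix'_mulVec, h]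
    ext i
    have : e (Sum.inl l) = Fin.castLE hd l := by
      ext
      simp [e]
    rw [LinearEquiv.coe_coe, Module.Basis.equivFun_self, this, Pi.single_apply]
    simp only [eq_comm]

theorem Module.Basis.linearIndependent_coe {k V J : Type*} [Field k] [AddCommGroup V] [Module k V]
    {W : Submodule k V} (w : Module.Basis J k W) : LinearIndependent k fun j => (w j : V) :=
  w.linearIndependent.map' W.subtype (Submodule.ker_subtype W)

/-! ### Independence over the constants; definable spaces are stable -/

namespace LinearODE

variable {C K : Type*} [Field C] [Field K] [Differential K] [Algebra (RatFunc C) K]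
  [DifferentialAlgebra (RatFunc C) K] [Algebra C K] [IsScalarTower C (RatFunc C) K]
  {n : ℕ} {A : Matrix (Fin n) (Fin n) (RatFunc C)}

theorem mem_range_of_deriv_eq_zero_of_containConstants [CharZero C]
    (h : Differential.ContainConstants (RatFunc C) K) {x : K} (hx : x′ = 0) :
    x ∈ (algebraMap C K).range := by
  obtain ⟨f, rfl⟩ := h.mem_range_of_deriv_eq_zero hx
  rw [deriv_algebraMap, map_eq_zero] at hx
  obtain ⟨c, rfl⟩ := RatFunc.mem_range_of_ddt_eq_zero hx
  exact ⟨c, IsScalarTower.algebraMap_apply C (RatFunc C) K c⟩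

/-- Solutions that are linearly independent over the constants are linearly independent over
`K`. -/
theorem linearIndependent_of_constants (hconst : ∀ x : K, x′ = 0 → x ∈ (algebraMap C K).range)
    {J : Type*} {v : J → solutionSpace K A}
    (hv : LinearIndependent C v) : LinearIndependent K fun j => (v j : Fin n → K) := by
  rw [linearIndependent_iff]
  intro l hl
  -- `U` is the space of `K`-relations among the `v j`. Differentiating `∑ l_j v_j = 0` gives `∑
  -- l_j′ v_j + A ∑ l_j v_j = 0`, so `U` is stable under the derivation and spanned by relations
  -- with constant coefficients. Those are relations over `C`, hence trivial.
  let U := LinearMap.ker (Finsupp.linearCombination K fun j => (v j : Fin n → K))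
  have hstable : ∀ u ∈ U, Finsupp.mapRange (fun x : K => x′) (map_zero _) u ∈ U := by
    intro u hu
    rw [LinearMap.mem_ker, Finsupp.linearCombination_apply] at hu ⊢
    rw [Finsupp.sum_of_support_subset _ Finsupp.support_mapRange _ (by simp)]
    have h0 : (A.map (algebraMap (RatFunc C) K)).mulVec (u.sum fun j a => a • (v j : Fin n → K))
        = 0 := by rw [hu, Matrix.mulVec_zero]
    rw [Finsupp.sum, Matrix.mulVec_sum] at h0
    ext i
    have hi := congrArg (fun x : K => x′) (congrFun hu i)
    have h0i := congrFun h0 i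
    have hs : ∀ j, ((v j : Fin n → K) i)′ =
        (A.map (algebraMap (RatFunc C) K)).mulVec (v j : Fin n → K) i :=
      fun j => congrFun (v j).2 i
    simp only [Finsupp.sum, Finset.sum_apply, Pi.smul_apply, smul_eq_mul, map_sum,
      Derivation.leibniz, Pi.zero_apply, map_zero, Finset.sum_add_distrib, hs,
      Matrix.mulVec_smul] at hi h0i
    rw [h0i, zero_add] at hi
    simpa [mul_comm] using hi
  have hmem := Submodule.mem_span_of_coeffwise_stable (I := Unit)
    (Finsupp.basisSingleOne (R := K) (ι := J)) U (fun _ x => x′) (by simp) (by simp)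
    (fun _ u hu => ⟨_, hstable u hu, fun s => by simp⟩) (u := l) hl
  suffices hset : {w : J →₀ K | w ∈ U ∧ ∀ s (_ : Unit), (Finsupp.basisSingleOne.repr w s)′ = 0} ⊆ {0} by
    have := Submodule.span_mono (R := K) hset hmem
    rwa [Submodule.span_zero_singleton, Submodule.mem_bot] at this
  rintro w ⟨hwU, hw⟩
  choose c hc using fun s => hconst (w s) (hw s ())
  have hsupp : ∀ s, c s ≠ 0 → s ∈ w.support := fun s hs => by
    rw [Finsupp.mem_support_iff, ← hc]
    simpa using hs
  let w₀ : J →₀ C := Finsupp.onFinset w.support c hsupp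
  have hw₀ : w₀ = 0 := by
    refine linearIndependent_iff.1 hv w₀ (Subtype.ext ?_)
    rw [Finsupp.linearCombination_apply, Finsupp.onFinset_sum _ (by simp)]
    rw [LinearMap.mem_ker, Finsupp.linearCombination_apply, Finsupp.sum] at hwU
    rw [Submodule.coe_sum, ZeroMemClass.coe_zero, ← hwU]
    refine Finset.sum_congr rfl fun s _ => ?_
    rw [← hc, Submodule.coe_smul, algebraMap_smul]
  ext s
  rw [← hc, show c s = w₀ s from rfl, hw₀]
  simp

theorem linearIndependent_basis (hconst : ∀ x : K, x′ = 0 → x ∈ (algebraMap C K).range)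
    {J : Type*} {W : Submodule C (solutionSpace K A)} (w : Module.Basis J C W) :
    LinearIndependent K fun j => ((w j : solutionSpace K A) : Fin n → K) := by
  have h := Module.Basis.linearIndependent_coe (V := solutionSpace K A) w
  exact linearIndependent_of_constants hconst h

/-- A `C`-basis stays independent over `K` inside `K^n`, so it is finite. -/
theorem exists_finite_basis (hconst : ∀ x : K, x′ = 0 → x ∈ (algebraMap C K).range)
    (W : Submodule C (solutionSpace K A)) :
    ∃ m : ℕ, Nonempty (Module.Basis (Fin m) C W) := by
  let b := Module.Basis.ofVectorSpace C W
  have := (linearIndependent_basis hconst b).finite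
  exact ⟨_, ⟨b.reindex (Finite.equivFin _)⟩⟩

/-- A solution in the `K`-span of a space of solutions belongs to that space. -/
theorem mem_of_mem_span (hconst : ∀ x : K, x′ = 0 → x ∈ (algebraMap C K).range)
    {W : Submodule C (solutionSpace K A)} {y : solutionSpace K A}
    (hy : (y : Fin n → K) ∈ Submodule.span K ((fun z : solutionSpace K A => (z : Fin n → K)) '' W)) :
    y ∈ W := by
  by_contra hyW
  let b := Module.Basis.ofVectorSpace C W
  have hb := b.linearIndependent.map' W.subtype (Submodule.ker_subtype W)
  have hspan : Submodule.span C (Set.range (W.subtype ∘ b)) = W := by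
    rw [Set.range_comp, Submodule.span_image, b.span_eq, Submodule.map_top, Submodule.range_subtype]
  -- If `y ∉ W`, adjoining `y` to a basis of `W` keeps independence over `C`, hence over `K`, so `y`
  -- is outside the `K`-span.
  have h := linearIndependent_of_constants hconst (hb.option (x := y) (by rwa [hspan]))
  rw [linearIndependent_option] at h
  refine h.2 (Submodule.span_le.2 ?_ hy)
  rintro _ ⟨z, hz, rfl⟩
  rw [← hspan] at hz
  change _ ∈ Submodule.span K _
  induction hz using Submodule.span_induction with
  | mem z hz =>
    obtain ⟨j, rfl⟩ := hz
    exact Submodule.subset_span ⟨j, rfl⟩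
  | zero => exact Submodule.zero_mem _
  | add z z' _ _ hz hz' => exact Submodule.add_mem _ hz hz'
  | smul c z _ hz =>
    beta_reduce
    rw [show ((c • z : solutionSpace K A) : Fin n → K) = algebraMap C K c • (z : Fin n → K) from
      (algebraMap_smul K c (z : Fin n → K)).symm]
    exact Submodule.smul_mem _ _ hz

/-- A definable space of solutions is stable under the differential Galois group. -/
theorem IsDefinable.mem_invtSubmodule
    (hconst : ∀ x : K, x′ = 0 → x ∈ (algebraMap C K).range)
    {W : Submodule C (solutionSpace K A)} (hW : IsDefinable W) :
    W ∈ (galoisRep (K := K) A).invtSubmodule := by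
  rw [Representation.mem_invtSubmodule]
  intro σ
  rw [Module.End.mem_invtSubmodule]
  intro y hy
  obtain ⟨m, w, M, hm, T, hT⟩ := hW
  refine mem_of_mem_span (y := galoisRep A σ y) hconst ?_
  set N := (M : Matrix (Fin n) (Fin n) (RatFunc C)).map (algebraMap (RatFunc C) K) with hN
  have hNinj : Function.Injective N.mulVec := by
    rw [Matrix.mulVec_injective_iff_isUnit]
    exact M.isUnit.map (algebraMap (RatFunc C) K).mapMatrix
  have hcomb : ∀ a : Fin m → K, ∀ i : Fin n,
      N.mulVec (∑ j, a j • ((w j : solutionSpace K A) : Fin n → K)) i =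
        if h : (i : ℕ) < m then (T : Matrix (Fin m) (Fin m) K).mulVec a ⟨i, h⟩ else 0 := by
    intro a i
    rw [Matrix.mulVec_sum, Finset.sum_apply]
    simp only [Matrix.mulVec_smul, Pi.smul_apply, hT]
    split_ifs with h
    · simp [Matrix.mulVec, dotProduct, mul_comm]
    · simp
  have hyw : (y : Fin n → K) = ∑ j, algebraMap C K (w.repr ⟨y, hy⟩ j) •
      ((w j : solutionSpace K A) : Fin n → K) := by
    have h := congrArg ((solutionSpace K A).subtype ∘ₗ W.subtype) (w.sum_repr ⟨y, hy⟩)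
    simp only [map_sum, map_smul] at h
    simp only [algebraMap_smul]
    exact h.symm
  -- The entries of `M` lie in `C(t)`, so `σ` commutes with it and the zero rows of `M y` stay zero.
  -- The upper rows determine the coefficients `a` through `T⁻¹`.
  have hσ : ∀ i, N.mulVec (galoisRep A σ y : Fin n → K) i =
      (σ : K ≃ₐ[RatFunc C] K) (N.mulVec (y : Fin n → K) i) := by
    intro i
    simp [Matrix.mulVec, dotProduct, hN, galoisRep]
  let t : Fin m → K := fun i => N.mulVec (galoisRep A σ y : Fin n → K) (Fin.castLE hm i)
  let a : Fin m → K := ((T⁻¹ : Matrix.GeneralLinearGroup (Fin m) K) : Matrix _ _ K).mulVec t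
  have hTa : (T : Matrix (Fin m) (Fin m) K).mulVec a = t := by
    rw [Matrix.mulVec_mulVec, ← Units.val_mul, mul_inv_cancel, Units.val_one, Matrix.one_mulVec]
  have hsum : (galoisRep A σ y : Fin n → K) =
      ∑ j, a j • ((w j : solutionSpace K A) : Fin n → K) := by
    refine hNinj (funext fun i => ?_)
    rw [hcomb, hTa]
    split_ifs with h
    · rfl
    · rw [hσ, hyw, hcomb, dif_neg h, map_zero]
  rw [hsum]
  exact Submodule.sum_mem _ fun j _ => Submodule.smul_mem _ _
    (Submodule.subset_span ⟨w j, (w j).2, rfl⟩)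

end LinearODE

/-! ### Galois descent and matrices over the base field -/

/-- Galois descent for subspaces of `K ^ n`: a subspace stable under a family of automorphisms of
`K` with common fixed field `k` is spanned by its vectors with entries in `k`. -/
theorem Submodule.mem_span_rational_of_stable {k K G : Type*} [Field k] [Field K] [Algebra k K]
    {n : ℕ} (U : Submodule K (Fin n → K)) (ρ : G → K ≃ₐ[k] K)
    (fixed : ∀ x, (∀ σ, ρ σ x = x) → x ∈ (algebraMap k K).range)
    (stable : ∀ σ, ∀ u ∈ U, (fun i => ρ σ (u i)) ∈ U) :
    U = Submodule.span K ((fun v : Fin n → k => fun i => algebraMap k K (v i)) ''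
      {v | (fun i => algebraMap k K (v i)) ∈ U}) := by
  refine le_antisymm (fun u hu => ?_) (Submodule.span_le.2 ?_)
  -- The maps `σ - id` kill 0 and 1 and preserve `U`; coefficients killed by all of them are fixed,
  -- hence lie in `k`.
  · have h := Submodule.mem_span_of_coeffwise_stable (Pi.basisFun K (Fin n)) U
      (fun (σ : G) x => ρ σ x - x) (by simp) (by simp)
      (fun σ u hu => ⟨_, U.sub_mem (stable σ u hu) hu, fun s => by simp⟩) hu
    refine Submodule.span_mono ?_ h
    rintro w ⟨hwU, hw⟩
    choose v hv using fun s => fixed (w s) fun σ => sub_eq_zero.1 (by simpa using hw s σ)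
    obtain rfl : (fun i => algebraMap k K (v i)) = w := funext hv
    exact ⟨v, hwU, rfl⟩
  · rintro _ ⟨v, hv, rfl⟩
    exact hv

/-- A subspace of `K ^ n` spanned by vectors with entries in `k` is mapped onto the span of the
first standard basis vectors by an invertible matrix over `k`. -/
theorem Submodule.exists_generalLinearGroup_of_span_rational {k K : Type*} [Field k] [Field K]
    [Algebra k K] {n : ℕ} {U : Submodule K (Fin n → K)}
    (hU : U = Submodule.span K ((fun v : Fin n → k => fun i => algebraMap k K (v i)) ''
      {v | (fun i => algebraMap k K (v i)) ∈ U})) :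
    ∃ (d : ℕ) (_ : d ≤ n) (u : Fin d → Fin n → K) (M : Matrix.GeneralLinearGroup (Fin n) k),
      LinearIndependent K u ∧ Submodule.span K (Set.range u) = U ∧
      ∀ (a : Fin d → K) (i : Fin n),
        ((M : Matrix (Fin n) (Fin n) k).map (algebraMap k K)).mulVec (∑ l, a l • u l) i =
          if h : (i : ℕ) < d then a ⟨i, h⟩ else 0 := by
  -- `U₀` is the `k`-space of rational vectors of `U`. Its adapted basis and matrix serve over `K`
  -- too, where `hcomb` also yields independence.
  let U₀ : Submodule k (Fin n → k) :=
    (U.restrictScalars k).comap ((Algebra.linearMap k K).compLeft (Fin n))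
  obtain ⟨d, hd, u, M, hM⟩ := U₀.exists_generalLinearGroup_mulVec_basis
  set N := (M : Matrix (Fin n) (Fin n) k).map (algebraMap k K)
  let u' : Fin d → Fin n → K := fun l i => algebraMap k K ((u l : Fin n → k) i)
  have hNu : ∀ l, N.mulVec (u' l) = Pi.single (Fin.castLE hd l) 1 := fun l => by
    ext i
    have h := congrArg (algebraMap k K) (congrFun (hM l) i)
    rw [RingHom.map_mulVec] at h
    refine h.trans ?_
    rw [Pi.single_apply, Pi.single_apply]
    split_ifs <;> simp
  have hcomb : ∀ (a : Fin d → K) (i : Fin n), N.mulVec (∑ l, a l • u' l) i =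
      if h : (i : ℕ) < d then a ⟨i, h⟩ else 0 := fun a i => by
    rw [Matrix.mulVec_sum, Finset.sum_apply]
    simp only [Matrix.mulVec_smul, hNu, Pi.smul_apply, Pi.single_apply, smul_eq_mul, mul_ite,
      mul_one, mul_zero]
    split_ifs with h
    · rw [Finset.sum_eq_single ⟨i, h⟩ (fun l _ hl => if_neg fun hi => hl (by ext; simp [hi]))
        (by simp)]
      exact if_pos rfl
    · exact Finset.sum_eq_zero fun l _ => if_neg fun hi => h (by rw [hi]; exact l.2)
  refine ⟨d, hd, u', M, ?_, le_antisymm (Submodule.span_le.2 ?_) ?_, hcomb⟩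
  · rw [Fintype.linearIndependent_iff]
    intro a ha l
    have h := hcomb a (Fin.castLE hd l)
    rw [ha, Matrix.mulVec_zero, dif_pos (show (Fin.castLE hd l : ℕ) < d from l.2)] at h
    exact h.symm
  · rintro _ ⟨l, rfl⟩
    exact (u l).2
  · rw [hU, Submodule.span_le]
    rintro _ ⟨v, hv, rfl⟩
    have h := congrArg U₀.subtype (u.sum_repr ⟨v, hv⟩)
    have hv' : (fun i => algebraMap k K (v i)) =
        ∑ l, algebraMap k K (u.repr ⟨v, hv⟩ l) • u' l := by
      ext i
      have := congrArg (algebraMap k K) (congrFun h i)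
      simp only [map_sum, map_smul, Finset.sum_apply, Pi.smul_apply, smul_eq_mul, map_mul,
        Submodule.subtype_apply] at this
      rw [← this, Finset.sum_apply]
      rfl
    beta_reduce
    rw [hv']
    exact Submodule.sum_mem _ fun l _ => Submodule.smul_mem _ _ (Submodule.subset_span ⟨l, rfl⟩)

/-- Two bases of the same subspace are related by an invertible matrix. -/
theorem LinearIndependent.exists_generalLinearGroup_of_span_eq {K V : Type*} [Field K]
    [AddCommGroup V] [Module K V] {d : ℕ} {w u : Fin d → V} (hw : LinearIndependent K w)
    (h : Submodule.span K (Set.range w) = Submodule.span K (Set.range u)) :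
    ∃ T : Matrix.GeneralLinearGroup (Fin d) K,
      ∀ j, w j = ∑ l, (T : Matrix (Fin d) (Fin d) K) l j • u l := by
  choose a ha using fun j => (Submodule.mem_span_range_iff_exists_fun K).1
    (h ▸ Submodule.subset_span (Set.mem_range_self j) : w j ∈ Submodule.span K (Set.range u))
  have hT : IsUnit (Matrix.of fun l j => a j l) := by
    rw [← Matrix.mulVec_injective_iff_isUnit, ← Matrix.coe_mulVecLin, injective_iff_map_eq_zero]
    intro x hx
    refine funext (Fintype.linearIndependent_iff.1 hw x ?_)
    have : ∀ l, ∑ j, x j * a j l = 0 := fun l => by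
      simpa [Matrix.mulVec, dotProduct, mul_comm] using congrFun hx l
    simp only [← ha, Finset.smul_sum, smul_smul]
    rw [Finset.sum_comm]
    simp only [← Finset.sum_smul, this, zero_smul, Finset.sum_const_zero]
  exact ⟨hT.unit, fun j => (ha j).symm⟩

/-! ### Stable spaces are definable -/

namespace LinearODE

variable {C K : Type*} [Field C] [Field K] [Differential K] [Algebra (RatFunc C) K]
  [DifferentialAlgebra (RatFunc C) K] [Algebra C K] [IsScalarTower C (RatFunc C) K]
  {n : ℕ} {A : Matrix (Fin n) (Fin n) (RatFunc C)}

/-- A basis over the constants of a space of solutions is a family of generators of its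
`K`-span. -/
theorem span_range_basis {J : Type*} [Fintype J] {W : Submodule C (solutionSpace K A)}
    (w : Module.Basis J C W) :
    Submodule.span K (Set.range fun j => ((w j : solutionSpace K A) : Fin n → K)) =
      Submodule.span K ((fun z : solutionSpace K A => (z : Fin n → K)) '' W) := by
  refine le_antisymm (Submodule.span_mono ?_) (Submodule.span_le.2 ?_)
  · rintro _ ⟨j, rfl⟩
    exact ⟨w j, (w j).2, rfl⟩
  · rintro _ ⟨z, hz, rfl⟩
    have h := congrArg ((solutionSpace K A).subtype ∘ₗ W.subtype) (w.sum_repr ⟨z, hz⟩)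
    simp only [map_sum, map_smul] at h
    have hzw : (z : Fin n → K) = ∑ j, algebraMap C K (w.repr ⟨z, hz⟩ j) •
        ((w j : solutionSpace K A) : Fin n → K) := by
      simp only [algebraMap_smul]
      exact h.symm
    beta_reduce
    rw [hzw]
    exact Submodule.sum_mem _ fun l _ => Submodule.smul_mem _ _ (Submodule.subset_span ⟨l, rfl⟩)

/-- A space of solutions whose `K`-span is spanned by vectors with entries in `C(t)` is
definable. -/
theorem isDefinable_of_span_rational
    (hconst : ∀ x : K, x′ = 0 → x ∈ (algebraMap C K).range)
    {W : Submodule C (solutionSpace K A)} {U : Submodule K (Fin n → K)}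
    (hWU : Submodule.span K ((fun z : solutionSpace K A => (z : Fin n → K)) '' W) = U)
    (hU : U = Submodule.span K ((fun v : Fin n → RatFunc C => fun i => algebraMap _ K (v i)) ''
      {v | (fun i => algebraMap (RatFunc C) K (v i)) ∈ U})) :
    IsDefinable W := by
  obtain ⟨d, hd, u, M, huind, huspan, hcomb⟩ :=
    Submodule.exists_generalLinearGroup_of_span_rational hU
  obtain ⟨m, ⟨w⟩⟩ := exists_finite_basis hconst W
  have hwind := linearIndependent_basis hconst w
  have hwspan := (span_range_basis w).trans hWU
  obtain rfl : d = m := by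
    have h1 := finrank_span_eq_card huind
    have h2 := finrank_span_eq_card hwind
    rw [huspan] at h1
    rw [hwspan, h1] at h2
    simpa using h2
  obtain ⟨T, hT⟩ := hwind.exists_generalLinearGroup_of_span_eq (hwspan.trans huspan.symm)
  refine ⟨_, w, M, hd, T, fun i j => ?_⟩
  beta_reduce
  rw [hT, hcomb]

end LinearODE

theorem mainTheorem8 {C K : Type*} [Field C] [IsAlgClosed C] [CharZero C]
    [Field K] [Differential K] [Algebra (RatFunc C) K] [DifferentialAlgebra (RatFunc C) K]
    [Algebra C K] [IsScalarTower C (RatFunc C) K]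
    {n : ℕ} (A : Matrix (Fin n) (Fin n) (RatFunc C))
    (hK : LinearODE.IsPicardVessiot (K := K) A)
    (W : Submodule C (LinearODE.solutionSpace K A)) :
    LinearODE.IsDefinable W ↔ W ∈ (LinearODE.galoisRep (K := K) A).invtSubmodule := by
  have hconst : ∀ x : K, x′ = 0 → x ∈ (algebraMap C K).range := fun x hx =>
    LinearODE.mem_range_of_deriv_eq_zero_of_containConstants hK.constants hx
  have hC : ∀ c : C, (algebraMap C K c)′ = 0 := fun c => by
    rw [IsScalarTower.algebraMap_apply C (RatFunc C) K, deriv_algebraMap,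
      RatFunc.deriv_algebraMap_const, map_zero]
  refine ⟨fun h => h.mem_invtSubmodule hconst, fun h => ?_⟩
  obtain ⟨F, hF, hgen⟩ := hK.generated
  have : CharZero (RatFunc C) :=
    charZero_of_injective_algebraMap (algebraMap C (RatFunc C)).injective
  -- Descent is applied to the `K`-span of `W`. It needs the fixed field to be `C(t)`, and the
  -- stability of the span, which follows from that of `W` because each `σ` acts semilinearly.
  refine LinearODE.isDefinable_of_span_rational hconst rfl
    (Submodule.mem_span_rational_of_stable _
      (fun σ : LinearODE.galoisGroup (RatFunc C) K => (σ : K ≃ₐ[RatFunc C] K)) ?_ ?_)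
  · intro x hx
    by_contra hxk
    obtain ⟨σ, hσ, hne⟩ := LinearODE.exists_mem_galoisGroup_ne hC hconst hF hgen hxk
    exact hne (hx ⟨σ, hσ⟩)
  · intro σ u hu
    induction hu using Submodule.span_induction with
    | mem u hu =>
      obtain ⟨z, hz, rfl⟩ := hu
      exact Submodule.subset_span ⟨LinearODE.galoisRep A σ z,
        (Representation.mem_invtSubmodule _).1 h σ hz, rfl⟩
    | zero =>
      simp only [Pi.zero_apply, map_zero]
      exact Submodule.zero_mem _
    | add u v _ _ hu hv => 
      simp only [Pi.add_apply, map_add]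
      exact Submodule.add_mem _ hu hv
    | smul a u _ hu =>
      simp only [Pi.smul_apply, smul_eq_mul, map_mul]
      exact Submodule.smul_mem _ ((σ : K ≃ₐ[RatFunc C] K) a) hu
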